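/- Let $D$ be a knot diagram. A crossing touches a region of $D$ (a component of the complement of the underlying projection, the unbounded one included) if at least one of its four corners lies in that region. The region crossing change at a region $R$ changes exactly the crossings that touch $R$, and the region freeze crossing change at $R$ changes exactly the crossings that do not touch $R$. A set of regions of $D$ is called ineffective if performing the region crossing changes at all of its members, one after another, leaves $D$ unchanged. Theorem. A knot diagram $D$ has exactly four ineffective sets $\mathcal{R}^*_1, \mathcal{R}^*_2, \mathcal{R}^*_3, \mathcal{R}^*_4$ of regions. If the cardinality of $\mathcal{R}^*_j$ is odd for some $j$, then for every crossing $c$ of $D$ there is a finite sequence of region freeze crossing changes, at regions of $D$, which transforms $D$ into the diagram obtained from $D$ by the crossing change at $c$. -/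

import Mathlib

/-!
# Knot diagrams, region crossing changes and region freeze crossing changes

A knot diagram is given by its underlying 4-valent plane graph, recorded as a combinatorial map
(rotation system) of genus zero, together with the over/under information at its crossings.
The elements of the finite type `δ` are the darts (half-edges): every crossing has four darts,
and every edge of the graph, that is, every arc between consecutive crossings, consists of two.
The simple closed curve without crossings is included, as the case in which `δ` is empty.
-/

/-- The underlying projection of a knot diagram on the sphere (equivalently, in the plane; the
unbounded region is a region like all others), with set of darts `δ`. -/
structure KnotProjection (δ : Type*) where
  /-- the other half of the edge to which a dart belongs -/
  edge : Equiv.Perm δ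
  /-- the next dart, counterclockwise, at the same crossing -/
  rot : Equiv.Perm δ
  edge_edge : ∀ d, edge (edge d) = d
  edge_ne : ∀ d, edge d ≠ d
  /-- every crossing has exactly four darts -/
  rot_four : ∀ d, rot (rot (rot (rot d))) = d
  rot_two_ne : ∀ d, rot (rot d) ≠ d
  /-- There is exactly one component: any two darts are joined by running along the edges and
  going straight ahead at the crossings. -/
  one_component : ∀ d e : δ, ∃ g ∈ Subgroup.closure ({edge, rot ^ 2} : Set (Equiv.Perm δ)), g d = e
  /-- The map has genus zero, `V - E + F = 2`. The vertices, edges and faces are the cycles of `rot`,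
  of `edge` and of `rot⁻¹ * edge`. -/
  planar : Nonempty δ →
    Nat.card (Quotient (Equiv.Perm.SameCycle.setoid rot)) +
      Nat.card (Quotient (Equiv.Perm.SameCycle.setoid (rot⁻¹ * edge))) =
    Nat.card (Quotient (Equiv.Perm.SameCycle.setoid edge)) + 2

namespace KnotProjection

variable {δ : Type*} (P : KnotProjection δ)

/-- The crossings: the cycles of the rotation. -/
def Crossing : Type _ := Quotient (Equiv.Perm.SameCycle.setoid P.rot)

/-- The crossing at which a dart starts. -/
def crossingOf (d : δ) : P.Crossing := Quotient.mk (Equiv.Perm.SameCycle.setoid P.rot) d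

/-- The faces: `rot⁻¹ * edge` sends a dart `d`, directed away from its crossing, to the next dart
along the boundary of the face on the left-hand side of `d`. -/
def Face : Type _ := Quotient (Equiv.Perm.SameCycle.setoid (P.rot⁻¹ * P.edge))

/-- The face on the left-hand side of a dart `d`; it contains the corner between `d` and `rot d`. -/
def faceOf (d : δ) : P.Face := Quotient.mk (Equiv.Perm.SameCycle.setoid (P.rot⁻¹ * P.edge)) d

/-- The regions, that is, the components of the complement of the projection: the faces if there is
a crossing, and the two sides of the simple closed curve if there is none. -/
def Region : Type _ := P.Face ⊕ {_side : Bool // IsEmpty δ}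

/-- The crossing `c` touches the region `R`: at least one of the four corners at `c` lies in `R`. -/
def Touches (c : P.Crossing) (R : P.Region) : Prop :=
  ∃ d : δ, P.crossingOf d = c ∧ Sum.inl (P.faceOf d) = R

end KnotProjection

/-- A knot diagram with projection `P`: at each crossing one of the two strands `{d, rot (rot d)}`
and `{rot d, rot (rot (rot d))}` is the over-strand. -/
structure KnotDiagram {δ : Type*} (P : KnotProjection δ) where
  /-- the dart belongs to the over-strand at its crossing -/
  isOver : δ → Prop
  isOver_rot : ∀ d, isOver (P.rot d) ↔ ¬ isOver d

namespace KnotDiagram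

variable {δ : Type*} {P : KnotProjection δ}

/-- Crossing changes at all crossings in `C`, and at no others. -/
def crossingChange (D : KnotDiagram P) (C : Set P.Crossing) : KnotDiagram P where
  isOver d := (P.crossingOf d ∈ C ∧ ¬ D.isOver d) ∨ (P.crossingOf d ∉ C ∧ D.isOver d)
  isOver_rot d := by
    have h : P.crossingOf (P.rot d) = P.crossingOf d :=
      Quotient.sound (s := Equiv.Perm.SameCycle.setoid P.rot)
        (Equiv.Perm.sameCycle_apply_left.2 (Equiv.Perm.SameCycle.refl P.rot d))
    rw [h, D.isOver_rot d]
    tauto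

/-- The region crossing change at `R` changes the crossings touching `R`. -/
def regionCrossingChange (D : KnotDiagram P) (R : P.Region) : KnotDiagram P :=
  D.crossingChange {c | P.Touches c R}

/-- The region freeze crossing change at `R` changes all crossings other than those touching `R`. -/
def regionFreezeCrossingChange (D : KnotDiagram P) (R : P.Region) : KnotDiagram P :=
  D.crossingChange {c | ¬ P.Touches c R}

/-- The region crossing changes at the members of a list of regions, one after another. -/
def regionCrossingChanges (D : KnotDiagram P) (l : List P.Region) : KnotDiagram P :=
  l.foldl regionCrossingChange D

/-- The region freeze crossing changes at the members of a list, one after another. -/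
def regionFreezeCrossingChanges (D : KnotDiagram P) (l : List P.Region) : KnotDiagram P :=
  l.foldl regionFreezeCrossingChange D

/-- A set of regions is ineffective if the region crossing changes at its members, one after another
(in any order, which does not matter), do not change the diagram. -/
def Ineffective (D : KnotDiagram P) (S : Finset P.Region) : Prop :=
  ∀ l : List P.Region, l.Nodup → (∀ R, R ∈ l ↔ R ∈ S) → D.regionCrossingChanges l = D

end KnotDiagram

/-! Over `ZMod 2`, performing region crossing changes adds up columns of the incidence matrix of
crossings and regions, so the ineffective sets are the vectors of its kernel. Euler's formula gives
two more regions than crossings (`card_region`). Once the rows are independent (`rank_touchMatrix`),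
the kernel therefore has dimension two, hence four elements, and every crossing change is produced
by some set `T` of regions. A freeze change adds the all-ones vector to the column of its region, so
freezing at `T` has the same effect if `T` has even size; if not, an odd ineffective set repairs the
parity.

For the independence, let `x` be a function on the crossings whose sum over the crossings touching
any given face is zero. At a reducible crossing, where opposite corners share a face, `x` vanishes
by induction on one side of the cutting curve (`eq_zero_of_separates`). At any other crossing the
four corners lie in distinct faces: adjacent ones differ in checkerboard colour. So `x`, read on
corners, sums to zero around every face and every crossing, and planarity makes it the coboundary of
an edge function `g` (`exists_potential`). Since `x` agrees on the corners of a crossing, `g` agrees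
on opposite edges there; a knot has one component, so `g` is constant and `x = 0`
(`eq_zero_of_sum_touches`). -/

theorem Equiv.Perm.SameCycle.induction {α : Type*} [Finite α] {f : Equiv.Perm α} {x y : α}
    (h : f.SameCycle x y) {p : α → Prop} (base : p x)
    (step : ∀ z, f.SameCycle x z → p z → p (f z)) : p y := by
  obtain ⟨n, rfl⟩ := h.exists_nat_pow_eq
  induction n with
  | zero => simpa using base
  | succ n ih =>
    rw [pow_succ', Equiv.Perm.mul_apply]
    exact step _ ⟨n, by simp⟩ (ih ⟨n, by simp⟩)

/-! ### Crossings, edges and faces: connectedness and the Euler count -/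

namespace KnotProjection

section Combinatorics

variable {δ : Type*} (P : KnotProjection δ)

/-- The edges: the cycles of the edge involution. -/
def Edge : Type _ := Quotient (Equiv.Perm.SameCycle.setoid P.edge)

/-- The edge to which a dart belongs. -/
def edgeOf (d : δ) : P.Edge := Quotient.mk (Equiv.Perm.SameCycle.setoid P.edge) d

theorem edgeOf_surjective : Function.Surjective P.edgeOf := Quotient.mk_surjective

theorem crossingOf_surjective : Function.Surjective P.crossingOf := Quotient.mk_surjective

theorem faceOf_surjective : Function.Surjective P.faceOf := Quotient.mk_surjective

instance [Finite δ] : Finite P.Edge := Finite.of_surjective _ P.edgeOf_surjective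

instance [Finite δ] : Finite P.Crossing := Finite.of_surjective _ P.crossingOf_surjective

instance [Finite δ] : Finite P.Face := Finite.of_surjective _ P.faceOf_surjective

instance [Finite δ] : Finite P.Region := inferInstanceAs (Finite (P.Face ⊕ _))

@[simp] theorem edgeOf_edge (d : δ) : P.edgeOf (P.edge d) = P.edgeOf d :=
  Quotient.sound (s := Equiv.Perm.SameCycle.setoid P.edge)
    (Equiv.Perm.sameCycle_apply_left.2 (Equiv.Perm.SameCycle.refl _ d))

@[simp] theorem crossingOf_rot (d : δ) : P.crossingOf (P.rot d) = P.crossingOf d :=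
  Quotient.sound (s := Equiv.Perm.SameCycle.setoid P.rot)
    (Equiv.Perm.sameCycle_apply_left.2 (Equiv.Perm.SameCycle.refl _ d))

@[simp] theorem faceOf_edge_rot (d : δ) : P.faceOf (P.edge (P.rot d)) = P.faceOf d := by
  refine Quotient.sound (s := Equiv.Perm.SameCycle.setoid (P.rot⁻¹ * P.edge))
    (Equiv.Perm.sameCycle_apply_left.1 ?_)
  simpa [P.edge_edge] using Equiv.Perm.SameCycle.refl (P.rot⁻¹ * P.edge) d

variable {P}

theorem edgeOf_eq_iff {d e : δ} : P.edgeOf d = P.edgeOf e ↔ P.edge.SameCycle d e :=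
  Quotient.eq (r := Equiv.Perm.SameCycle.setoid P.edge)

theorem crossingOf_eq_iff_sameCycle {d e : δ} :
    P.crossingOf d = P.crossingOf e ↔ P.rot.SameCycle d e :=
  Quotient.eq (r := Equiv.Perm.SameCycle.setoid P.rot)

theorem faceOf_eq_iff {d e : δ} :
    P.faceOf d = P.faceOf e ↔ (P.rot⁻¹ * P.edge).SameCycle d e :=
  Quotient.eq (r := Equiv.Perm.SameCycle.setoid (P.rot⁻¹ * P.edge))

theorem rot_ne (d : δ) : P.rot d ≠ d := fun h => P.rot_two_ne d (by rw [h, h])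

theorem edgeOf_eq_iff_or [Finite δ] {d e : δ} :
    P.edgeOf e = P.edgeOf d ↔ e = d ∨ e = P.edge d := by
  constructor
  · intro h
    refine (edgeOf_eq_iff.1 h.symm).induction (p := fun e => e = d ∨ e = P.edge d) (.inl rfl) ?_
    rintro z - (rfl | rfl)
    · exact .inr rfl
    · exact .inl (P.edge_edge d)
  · rintro (rfl | rfl) <;> simp

theorem crossingOf_eq_iff [Finite δ] {d e : δ} :
    P.crossingOf e = P.crossingOf d ↔
      e = d ∨ e = P.rot d ∨ e = P.rot (P.rot d) ∨ e = P.rot (P.rot (P.rot d)) := by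
  constructor
  · intro h
    refine (crossingOf_eq_iff_sameCycle.1 h.symm).induction (p := fun e => e = d ∨ e = P.rot d ∨
      e = P.rot (P.rot d) ∨ e = P.rot (P.rot (P.rot d))) (.inl rfl) ?_
    rintro z - (rfl | rfl | rfl | rfl)
    · exact .inr (.inl rfl)
    · exact .inr (.inr (.inl rfl))
    · exact .inr (.inr (.inr rfl))
    · exact .inl (P.rot_four d)
  · rintro (rfl | rfl | rfl | rfl) <;> simp

/-- A property of darts which passes to the next dart along the boundary of a face holds at all
darts of the face or at none. -/
theorem of_faceOf_eq [Finite δ] {d e : δ} (h : P.faceOf d = P.faceOf e) {p : δ → Prop} (base : p d)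
    (step : ∀ z, P.faceOf z = P.faceOf d → p (P.edge (P.rot z)) → p z) : p e := by
  refine (faceOf_eq_iff.1 h).induction base fun z hz hp => ?_
  have h' := faceOf_eq_iff.2 hz
  refine step _ ?_ ?_
  · rw [h', ← P.faceOf_edge_rot]
    simp [P.edge_edge]
  · simpa [P.edge_edge] using hp

/-- A function of the darts which is constant on edges and on strands through crossings is
constant. -/
theorem eq_of_straight {α : Type*} {f : δ → α} (hedge : ∀ d, f (P.edge d) = f d)
    (hrot : ∀ d, f (P.rot (P.rot d)) = f d) (d e : δ) : f e = f d := by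
  obtain ⟨g, hg, rfl⟩ := P.one_component d e
  have : ∀ d, f (g d) = f d := by
    induction hg using Subgroup.closure_induction with
    | mem x hx =>
      rcases hx with rfl | rfl
      · exact hedge
      · exact hrot
    | one => simp
    | mul x y _ _ hx hy => intro d; rw [Equiv.Perm.mul_apply, hx, hy]
    | inv x _ hx => intro d; simpa using (hx (x⁻¹ d)).symm
  exact this d

/-- A function of the darts which is constant on edges and at crossings is constant. -/
theorem eq_of_connected {α : Type*} {f : δ → α} (hedge : ∀ d, f (P.edge d) = f d)
    (hrot : ∀ d, f (P.rot d) = f d) (d e : δ) : f e = f d :=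
  eq_of_straight hedge (fun d => by rw [hrot, hrot]) d e

open scoped Classical in
theorem sum_crossingOf_eq [Fintype δ] {M : Type*} [AddCommMonoid M] (f : δ → M) (d : δ) :
    ∑ e with P.crossingOf e = P.crossingOf d, f e =
      f d + f (P.rot d) + f (P.rot (P.rot d)) + f (P.rot (P.rot (P.rot d))) := by
  have h : (Finset.univ.filter fun e => P.crossingOf e = P.crossingOf d) =
      {d, P.rot d, P.rot (P.rot d), P.rot (P.rot (P.rot d))} := by
    ext e
    simp [crossingOf_eq_iff]
  have h0 : P.rot (P.rot (P.rot d)) ≠ d := fun h => rot_ne d (by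
    nth_rewrite 2 [← P.rot_four d]; rw [h])
  rw [h, Finset.sum_insert, Finset.sum_insert, Finset.sum_insert, Finset.sum_singleton]
  · simp only [add_assoc]
  · simpa using (rot_ne _).symm
  · simpa using ⟨(rot_ne d).symm, (P.rot_two_ne d).symm⟩
  · simpa using ⟨(rot_ne d).symm, (P.rot_two_ne d).symm, h0.symm⟩

open scoped Classical in
theorem sum_eq_sum_crossings [Fintype δ] [Fintype P.Crossing] {M : Type*} [AddCommMonoid M]
    (f : δ → M) : ∑ d, f d = ∑ c : P.Crossing, ∑ d with P.crossingOf d = c, f d :=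
  (Finset.sum_fiberwise _ _ _).symm

variable (P)

theorem card_eq_four_mul [Finite δ] : Nat.card δ = 4 * Nat.card P.Crossing := by
  classical
  have := Fintype.ofFinite δ
  have := Fintype.ofFinite P.Crossing
  rw [Nat.card_eq_fintype_card, Nat.card_eq_fintype_card, Fintype.card_eq_sum_ones,
    sum_eq_sum_crossings (P := P), mul_comm, ← smul_eq_mul, ← Finset.card_univ, ← Finset.sum_const]
  refine Finset.sum_congr rfl fun c _ => ?_
  obtain ⟨d, rfl⟩ := P.crossingOf_surjective c
  rw [sum_crossingOf_eq]

theorem card_eq_two_mul [Finite δ] : Nat.card δ = 2 * Nat.card P.Edge := by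
  classical
  have := Fintype.ofFinite δ
  have := Fintype.ofFinite P.Edge
  rw [Nat.card_eq_fintype_card, Nat.card_eq_fintype_card, Fintype.card_eq_sum_ones,
    ← Finset.sum_fiberwise (g := P.edgeOf), mul_comm, ← smul_eq_mul, ← Finset.card_univ,
    ← Finset.sum_const]
  refine Finset.sum_congr rfl fun c _ => ?_
  obtain ⟨d, rfl⟩ := P.edgeOf_surjective c
  have h : (Finset.univ.filter fun e => P.edgeOf e = P.edgeOf d) = {d, P.edge d} := by
    ext e
    simp [edgeOf_eq_iff_or]
  rw [h, Finset.sum_pair (P.edge_ne d).symm]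

theorem card_crossing_add_card_face [Nonempty δ] :
    Nat.card P.Crossing + Nat.card P.Face = Nat.card P.Edge + 2 :=
  P.planar ‹_›

/-- Counting darts in two ways gives `E = 2V`, so Euler's formula reads `F = V + 2`; without
crossings, the two sides of the curve are the regions. -/
theorem card_region [Finite δ] : Nat.card P.Region = Nat.card P.Crossing + 2 := by
  have h : Nat.card P.Region = Nat.card P.Face + Nat.card {_side : Bool // IsEmpty δ} :=
    Nat.card_sum
  cases isEmpty_or_nonempty δ with
  | inl hδ =>
    have : IsEmpty P.Face := P.faceOf_surjective.isEmpty
    have : IsEmpty P.Crossing := P.crossingOf_surjective.isEmpty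
    have h2 : Nat.card {_side : Bool // IsEmpty δ} = 2 := by
      rw [Nat.card_congr (Equiv.subtypeUnivEquiv fun _ => hδ)]
      simp
    rw [h, h2, Nat.card_of_isEmpty, Nat.card_of_isEmpty]
  | inr hδ =>
    have : IsEmpty {_side : Bool // IsEmpty δ} := ⟨fun x => not_isEmpty_of_nonempty δ x.2⟩
    have h1 := P.card_eq_four_mul
    have h2 := P.card_eq_two_mul
    have h3 := P.card_crossing_add_card_face
    rw [h, Nat.card_of_isEmpty (α := {_side : Bool // IsEmpty δ})]
    omega

end Combinatorics

end KnotProjection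

/-! ### Mod 2 homology of the sphere, on corners -/

/-- The dot product on `ι → K`, as a bilinear form. -/
def dotForm (K ι : Type*) [Field K] [Fintype ι] : LinearMap.BilinForm K (ι → K) :=
  dotProductBilin K K

@[simp] theorem dotForm_apply {K ι : Type*} [Field K] [Fintype ι] (v w : ι → K) :
    dotForm K ι v w = ∑ i, v i * w i := rfl

theorem dotForm_isRefl (K ι : Type*) [Field K] [Fintype ι] : (dotForm K ι).IsRefl := by
  intro v w h
  rw [dotForm_apply] at h ⊢
  simpa only [mul_comm] using h

theorem dotForm_nondegenerate (K ι : Type*) [Field K] [Fintype ι] :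
    (dotForm K ι).Nondegenerate := by
  classical
  refine ((dotForm_isRefl K ι).nondegenerate_iff_separatingLeft).2 fun v h => ?_
  funext i
  simpa [Pi.single_apply] using h (Pi.single i 1)

namespace KnotProjection

section Homology

variable {δ : Type*} (P : KnotProjection δ)

/-- The coboundary of a function on the edges, as a function on the corners: a corner lies between
two edges. -/
def edgeCoboundary : (P.Edge → ZMod 2) →ₗ[ZMod 2] (δ → ZMod 2) where
  toFun g d := g (P.edgeOf d) + g (P.edgeOf (P.rot d))
  map_add' g h := by funext d; simp only [Pi.add_apply]; ring
  map_smul' k g := by funext d; simp only [Pi.smul_apply, smul_eq_mul, RingHom.id_apply]; ring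

/-- A corner lies in one face and at one crossing. -/
def cornerSum :
    ((P.Face → ZMod 2) × (P.Crossing → ZMod 2)) →ₗ[ZMod 2] (δ → ZMod 2) where
  toFun x d := x.1 (P.faceOf d) + x.2 (P.crossingOf d)
  map_add' g h := by funext d; simp only [Pi.add_apply, Prod.fst_add, Prod.snd_add]; ring
  map_smul' k g := by
    funext d
    simp only [Pi.smul_apply, smul_eq_mul, RingHom.id_apply, Prod.smul_fst, Prod.smul_snd]; ring

theorem finrank_pi_eq_natCard {ι : Type*} [Finite ι] :
    Module.finrank (ZMod 2) (ι → ZMod 2) = Nat.card ι := by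
  have := Fintype.ofFinite ι
  rw [Module.finrank_fintype_fun_eq_card, Nat.card_eq_fintype_card]

theorem finrank_ker_edgeCoboundary_le : Module.finrank (ZMod 2) P.edgeCoboundary.ker ≤ 1 := by
  have h1 : (1 : P.Edge → ZMod 2) ∈ P.edgeCoboundary.ker := by
    rw [LinearMap.mem_ker]; funext d; exact CharTwo.add_self_eq_zero _
  refine finrank_le_one ⟨1, h1⟩ ?_
  rintro ⟨g, hg⟩
  rw [LinearMap.mem_ker] at hg
  rcases isEmpty_or_nonempty δ with hδ | ⟨⟨d⟩⟩
  · have : IsEmpty P.Edge := P.edgeOf_surjective.isEmpty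
    exact ⟨0, Subtype.ext (Subsingleton.elim _ _)⟩
  · refine ⟨g (P.edgeOf d), Subtype.ext (funext fun e => ?_)⟩
    obtain ⟨e, rfl⟩ := P.edgeOf_surjective e
    have := P.eq_of_connected (f := fun d => g (P.edgeOf d)) (by simp)
      (fun d => (CharTwo.add_eq_zero.1 (congrFun hg d)).symm) e d
    simpa using this

/-- Kernel pairs agree at every corner, so by connectedness both components are the same constant.
-/
theorem finrank_ker_cornerSum_le : Module.finrank (ZMod 2) P.cornerSum.ker ≤ 1 := by
  have h1 : (1 : (P.Face → ZMod 2) × (P.Crossing → ZMod 2)) ∈ P.cornerSum.ker := by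
    rw [LinearMap.mem_ker]; funext d; exact CharTwo.add_self_eq_zero _
  refine finrank_le_one ⟨1, h1⟩ ?_
  rintro ⟨⟨a, b⟩, hg⟩
  rw [LinearMap.mem_ker] at hg
  have hab : ∀ d, a (P.faceOf d) = b (P.crossingOf d) :=
    fun d => CharTwo.add_eq_zero.1 (congrFun hg d)
  rcases isEmpty_or_nonempty δ with hδ | ⟨⟨d⟩⟩
  · have : IsEmpty P.Face := P.faceOf_surjective.isEmpty
    have : IsEmpty P.Crossing := P.crossingOf_surjective.isEmpty
    exact ⟨0, Subtype.ext (Subsingleton.elim _ _)⟩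
  · have hrot : ∀ d, a (P.faceOf (P.rot d)) = a (P.faceOf d) := fun d => by simp [hab]
    have hedge : ∀ d, a (P.faceOf (P.edge d)) = a (P.faceOf d) := fun d => by
      obtain ⟨d, rfl⟩ := P.rot.surjective d
      rw [P.faceOf_edge_rot, hrot]
    have h := P.eq_of_connected (f := fun d => a (P.faceOf d)) hedge hrot
    refine ⟨a (P.faceOf d), Subtype.ext (Prod.ext (funext fun e => ?_) (funext fun e => ?_))⟩
    · obtain ⟨e, rfl⟩ := P.faceOf_surjective e
      simpa using h e d
    · obtain ⟨e, rfl⟩ := P.crossingOf_surjective e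
      simpa [← hab] using h e d

variable [Fintype δ]

theorem range_cornerSum_le :
    P.cornerSum.range ≤ (dotForm (ZMod 2) δ).orthogonal P.edgeCoboundary.range := by
  rintro _ ⟨⟨a, b⟩, rfl⟩ _ ⟨g, rfl⟩
  change ∑ d, (g (P.edgeOf d) + g (P.edgeOf (P.rot d))) *
    (a (P.faceOf d) + b (P.crossingOf d)) = 0
  -- The permutation `d ↦ edge (rot d)` walks around a face, and `rot` around a crossing; reindexing
  -- makes the two terms of the coboundary cancel.
  have h1 : ∑ d, g (P.edgeOf (P.rot d)) * a (P.faceOf d) = ∑ d, g (P.edgeOf d) * a (P.faceOf d) := by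
    rw [← (P.rot.trans P.edge).sum_comp (fun d => g (P.edgeOf d) * a (P.faceOf d))]
    simp
  have h2 : ∑ d, g (P.edgeOf (P.rot d)) * b (P.crossingOf d) =
      ∑ d, g (P.edgeOf d) * b (P.crossingOf d) := by
    rw [← Equiv.sum_comp P.rot (fun d => g (P.edgeOf d) * b (P.crossingOf d))]
    simp
  simp only [add_mul, mul_add, Finset.sum_add_distrib, h1, h2]
  rw [add_add_add_comm, CharTwo.add_self_eq_zero]

/-- The first homology of the sphere vanishes. -/
theorem range_cornerSum :
    P.cornerSum.range = (dotForm (ZMod 2) δ).orthogonal P.edgeCoboundary.range := by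
  refine Submodule.eq_of_le_of_finrank_le P.range_cornerSum_le ?_
  rw [LinearMap.BilinForm.finrank_orthogonal (dotForm_nondegenerate _ _), finrank_pi_eq_natCard]
  rcases isEmpty_or_nonempty δ with hδ | hδ
  · simp
  · have h1 := P.edgeCoboundary.finrank_range_add_finrank_ker
    have h2 := P.cornerSum.finrank_range_add_finrank_ker
    rw [finrank_pi_eq_natCard] at h1
    rw [Module.finrank_prod, finrank_pi_eq_natCard, finrank_pi_eq_natCard] at h2
    have h3 := P.finrank_ker_edgeCoboundary_le
    have h4 := P.finrank_ker_cornerSum_le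
    have h5 := P.card_crossing_add_card_face
    have h6 := P.card_eq_two_mul
    omega

theorem range_edgeCoboundary :
    P.edgeCoboundary.range = (dotForm (ZMod 2) δ).orthogonal P.cornerSum.range := by
  rw [range_cornerSum, LinearMap.BilinForm.orthogonal_orthogonal (dotForm_nondegenerate _ _)
    (dotForm_isRefl _ _)]

variable {P}

open scoped Classical in
/-- A function on the corners with sum zero around each face and each crossing is a coboundary. -/
theorem exists_potential {z : δ → ZMod 2}
    (hface : ∀ f : P.Face, ∑ d with P.faceOf d = f, z d = 0)
    (hcrossing : ∀ c : P.Crossing, ∑ d with P.crossingOf d = c, z d = 0) :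
    ∃ g : δ → ZMod 2, (∀ d, g (P.edge d) = g d) ∧ ∀ d, z d = g d + g (P.rot d) := by
  have := Fintype.ofFinite P.Face
  have := Fintype.ofFinite P.Crossing
  have hz : z ∈ P.edgeCoboundary.range := by
    rw [range_edgeCoboundary]
    rintro _ ⟨⟨a, b⟩, rfl⟩
    change ∑ d, (a (P.faceOf d) + b (P.crossingOf d)) * z d = 0
    simp only [add_mul, Finset.sum_add_distrib]
    rw [← Finset.sum_fiberwise (g := P.faceOf), ← Finset.sum_fiberwise (g := P.crossingOf)
      (f := fun d => b (P.crossingOf d) * z d), Finset.sum_eq_zero, Finset.sum_eq_zero, add_zero]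
    · intro c _
      rw [← mul_zero (b c), ← hcrossing c, Finset.mul_sum]
      refine Finset.sum_congr rfl fun d hd => ?_
      rw [(Finset.mem_filter.1 hd).2]
    · intro f _
      rw [← mul_zero (a f), ← hface f, Finset.mul_sum]
      refine Finset.sum_congr rfl fun d hd => ?_
      rw [(Finset.mem_filter.1 hd).2]
  obtain ⟨g, rfl⟩ := hz
  exact ⟨fun d => g (P.edgeOf d), by simp, fun d => rfl⟩

/-- The checkerboard colouring, obtained from any choice `t` of a strand at each crossing. -/
theorem exists_checkerboard {t : δ → ZMod 2} (ht : ∀ d, t (P.rot d) = t d + 1) :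
    ∃ a : P.Face → ZMod 2, ∀ d, a (P.faceOf (P.rot d)) = a (P.faceOf d) + 1 := by
  have h : t ∈ P.cornerSum.range := by
    rw [range_cornerSum]
    rintro _ ⟨g, rfl⟩
    change ∑ d, (g (P.edgeOf d) + g (P.edgeOf (P.rot d))) * t d = 0
    -- Because `t` alternates, the pairing collapses to the sum of `g` over all darts, in which each
    -- edge occurs twice.
    have h1 : ∑ d, g (P.edgeOf (P.rot d)) * t d = ∑ d, g (P.edgeOf d) * (t d + 1) := by
      rw [← Equiv.sum_comp P.rot (fun d => g (P.edgeOf d) * (t d + 1))]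
      refine Finset.sum_congr rfl fun d _ => ?_
      rw [ht, add_assoc, CharTwo.add_self_eq_zero, add_zero]
    simp only [add_mul, Finset.sum_add_distrib, h1, mul_add, mul_one]
    rw [← add_assoc, CharTwo.add_self_eq_zero, zero_add]
    refine Finset.sum_ninvolution P.edge (fun d => ?_) (fun d _ => P.edge_ne d) (by simp)
      P.edge_edge
    rw [edgeOf_edge, CharTwo.add_self_eq_zero]
  obtain ⟨⟨a, b⟩, h⟩ := h
  refine ⟨a, fun d => ?_⟩
  have h1 := ht d
  rw [← h] at h1
  change a (P.faceOf (P.rot d)) + b (P.crossingOf (P.rot d)) =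
    a (P.faceOf d) + b (P.crossingOf d) + 1 at h1
  rw [crossingOf_rot] at h1
  linear_combination h1

end Homology

end KnotProjection

/-! ### Reducible crossings and independence of the rows -/

namespace KnotProjection

section Reducible

variable {δ : Type*} {P : KnotProjection δ}

variable (P) in
/-- The set `A` of darts is the part, on the side of `P.rot d`, of a diagram which is cut in two by
a curve that passes through the crossing of `d`, from the corner of `d` to the opposite one. -/
structure Separates (d : δ) (A : Set δ) : Prop where
  edge_mem : ∀ e, P.edge e ∈ A ↔ e ∈ A
  rot_mem : ∀ e, e ≠ d → e ≠ P.rot (P.rot d) → (P.rot e ∈ A ↔ e ∈ A)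
  notMem : d ∉ A
  rot_mem_self : P.rot d ∈ A

namespace Separates

variable {d e e' : δ} {A B : Set δ}

theorem rot_rot_mem (h : P.Separates d A) : P.rot (P.rot d) ∈ A :=
  (h.rot_mem _ (rot_ne d) (rot_ne _).symm).2 h.rot_mem_self

theorem rot_rot_rot_notMem (h : P.Separates d A) : P.rot (P.rot (P.rot d)) ∉ A := by
  have h0 : P.rot (P.rot (P.rot d)) ≠ d := fun h => rot_ne d (by
    nth_rewrite 2 [← P.rot_four d]; rw [h])
  rw [← h.rot_mem _ h0 (rot_ne _), P.rot_four]
  exact h.notMem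

/-- The opposite dart sees the two sides of the curve exchanged. -/
theorem compl (h : P.Separates d A) : P.Separates (P.rot (P.rot d)) Aᶜ where
  edge_mem e := not_congr (h.edge_mem e)
  rot_mem e h1 h2 := not_congr (h.rot_mem e (by rwa [P.rot_four] at h2) h1)
  notMem := not_not.2 h.rot_rot_mem
  rot_mem_self := h.rot_rot_rot_notMem

theorem rot_mem_of_ne (h : P.Separates d A) (he : P.crossingOf e ≠ P.crossingOf d) :
    P.rot e ∈ A ↔ e ∈ A :=
  h.rot_mem e (by rintro rfl; exact he rfl) (by rintro rfl; simp at he)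

theorem mem_iff_of_crossingOf_eq [Finite δ] (h : P.Separates d A)
    (he : P.crossingOf e ≠ P.crossingOf d) (hee' : P.crossingOf e' = P.crossingOf e) :
    e' ∈ A ↔ e ∈ A := by
  have h1 := h.rot_mem_of_ne he
  have h2 := h.rot_mem_of_ne (e := P.rot e) (by simpa using he)
  have h3 := h.rot_mem_of_ne (e := P.rot (P.rot e)) (by simpa using he)
  rcases crossingOf_eq_iff.1 hee' with rfl | rfl | rfl | rfl
  · rfl
  · exact h1
  · exact h2.trans h1
  · exact h3.trans (h2.trans h1)

/-- The curve is crossed only at the corners of `d` and `rot (rot d)`, both in the face of `d`; the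
boundary of any other face stays on one side. -/
theorem mem_of_faceOf_eq [Finite δ] (h : P.Separates d A)
    (hd : P.faceOf d = P.faceOf (P.rot (P.rot d))) (he : P.faceOf e ≠ P.faceOf d)
    (hee' : P.faceOf e' = P.faceOf e) (heA : e ∈ A) : e' ∈ A := by
  refine of_faceOf_eq hee'.symm (p := (· ∈ A)) heA fun z hz hzA => ?_
  rw [h.edge_mem] at hzA
  refine (h.rot_mem z ?_ ?_).1 hzA
  · rintro rfl
    exact he hz.symm
  · rintro rfl
    exact he (hz.symm.trans hd.symm)

/-- The set `B \ A` is closed under `edge` and `rot` in both directions, hence is everything or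
empty by connectedness, and it misses `e`. Strictness is also witnessed by `e`. -/
theorem ssubset [Finite δ] (h : P.Separates d A) (h' : P.Separates e B) (heA : e ∈ A)
    (hne : P.crossingOf e ≠ P.crossingOf d) (hdB : d ∉ B) : B ⊂ A := by
  have hrot : ∀ c, (P.rot c ∈ B ∧ P.rot c ∉ A) = (c ∈ B ∧ c ∉ A) := fun c => by
    by_cases hcd : P.crossingOf c = P.crossingOf d
    · have h1 := h'.mem_iff_of_crossingOf_eq hne.symm hcd
      have h2 := h'.mem_iff_of_crossingOf_eq (e' := P.rot c) hne.symm (by simpa using hcd)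
      simp [h1, h2, hdB]
    · by_cases hce : P.crossingOf c = P.crossingOf e
      · have h1 := h.mem_iff_of_crossingOf_eq hne hce
        have h2 := h.mem_iff_of_crossingOf_eq (e' := P.rot c) hne (by simpa using hce)
        simp [h1, h2, heA]
      · rw [h.rot_mem_of_ne hcd, h'.rot_mem_of_ne hce]
  have hconst := eq_of_connected (P := P) (f := fun c => c ∈ B ∧ c ∉ A)
    (fun c => by simp only [h.edge_mem, h'.edge_mem]) hrot e
  refine ⟨fun c hc => ?_, fun hAB => h'.notMem (hAB heA)⟩
  by_contra hcA
  exact ((hconst c).mp ⟨hc, hcA⟩).2 heA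

end Separates

open scoped Classical in
/-- If opposite corners of a crossing lie in the same face then the crossing is reducible. -/
theorem exists_separates [Finite δ] {d : δ} (h : P.faceOf d = P.faceOf (P.rot (P.rot d))) :
    ∃ A, P.Separates d A := by
  have := Fintype.ofFinite δ
  obtain ⟨g, hg, hz⟩ := exists_potential (P := P)
    -- This cochain is dual to the closed curve through the crossing and the face; its two corners
    -- share both, so all sums vanish. The potential changes exactly across the curve.
    (z := fun e => (if e = d then 1 else 0) + (if e = P.rot (P.rot d) then 1 else 0))
    (fun f => by
      rw [Finset.sum_add_distrib, Finset.sum_ite_eq', Finset.sum_ite_eq']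
      simp [h, CharTwo.add_self_eq_zero])
    (fun c => by
      rw [Finset.sum_add_distrib, Finset.sum_ite_eq', Finset.sum_ite_eq']
      simp [CharTwo.add_self_eq_zero])
  refine ⟨{e | g e ≠ g d}, fun e => by simp [hg], fun e h1 h2 => ?_, by simp, fun h1 => ?_⟩
  · have := hz e
    rw [if_neg h1, if_neg h2, add_zero, eq_comm, CharTwo.add_eq_zero] at this
    simp [this]
  · have := hz d
    rw [if_pos rfl, if_neg (P.rot_two_ne d).symm, h1, CharTwo.add_self_eq_zero] at this
    simp at this

/-- Of the two sides of the curve at `e`, the one avoiding `d` is taken; this is the descent for the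
induction on the size of a side. -/
theorem exists_separates_ssubset [Finite δ] {d e : δ} {A : Set δ} (h : P.Separates d A)
    (he : P.faceOf e = P.faceOf (P.rot (P.rot e))) (heA : e ∈ A)
    (hne : P.crossingOf e ≠ P.crossingOf d) :
    ∃ e' B, P.crossingOf e' = P.crossingOf e ∧ P.faceOf e' = P.faceOf (P.rot (P.rot e')) ∧
      P.Separates e' B ∧ B ⊂ A := by
  obtain ⟨B, hB⟩ := exists_separates he
  by_cases hdB : d ∈ B
  · refine ⟨P.rot (P.rot e), Bᶜ, by simp, by rw [P.rot_four, he], hB.compl,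
      h.ssubset hB.compl ?_ (by simpa using hne) (by simpa using hdB)⟩
    exact (h.mem_iff_of_crossingOf_eq hne (by simp)).2 heA
  · exact ⟨e, B, rfl, he, hB, h.ssubset hB heA hne hdB⟩

open scoped Classical in
/-- A function on the crossings whose sum over the crossings touching `f` vanishes for each face `f`
is zero at the reducible crossings. -/
theorem eq_zero_of_separates [Finite δ] [Fintype P.Crossing]
    {a : P.Face → ZMod 2} (ha : ∀ d, a (P.faceOf (P.rot d)) = a (P.faceOf d) + 1)
    {x : P.Crossing → ZMod 2} (hx : ∀ f : P.Face, ∑ c with P.Touches c (.inl f), x c = 0)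
    {d : δ} {A : Set δ} (hA : P.Separates d A) (hd : P.faceOf d = P.faceOf (P.rot (P.rot d))) :
    x (P.crossingOf d) = 0 := by
  induction hn : A.ncard using Nat.strong_induction_on generalizing d A with
  | _ n ih =>
  subst hn
  have := Fintype.ofFinite P.Face
  have hdec : ∀ u v : ZMod 2, u ≠ v ↔ u = v + 1 := by decide
  have hself : ∀ u : ZMod 2, u ≠ u + 1 := by decide
  have hadd : ∀ u : ZMod 2, u + 1 + 1 = u := by decide
  -- The face of `d` is the only one straddling the curve. Taking the faces of the other colour
  -- leaves only faces lying wholly inside or outside `A`.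
  let Φ : Finset P.Face :=
    Finset.univ.filter fun f => a f = a (P.faceOf d) + 1 ∧ ∃ e ∈ A, P.faceOf e = f
  have hmem : ∀ e, P.faceOf e ∈ Φ ↔ a (P.faceOf e) = a (P.faceOf d) + 1 ∧ e ∈ A := by
    intro e
    simp only [Φ, Finset.mem_filter, Finset.mem_univ, true_and]
    refine and_congr_right fun h => ⟨?_, fun he => ⟨e, he, rfl⟩⟩
    rintro ⟨e', he', h'⟩
    refine hA.mem_of_faceOf_eq hd (fun h2 => ?_) h'.symm he'
    rw [← h', h2] at h
    exact hself _ h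
  have hfilter : ∀ c f, f ∈ Φ.filter (fun f => P.Touches c (.inl f)) ↔
      ∃ e, P.crossingOf e = c ∧ P.faceOf e = f ∧ a f = a (P.faceOf d) + 1 ∧ e ∈ A := by
    intro c f
    simp only [Finset.mem_filter, Touches, Sum.inl.injEq]
    constructor
    · rintro ⟨hf, e, rfl, rfl⟩
      exact ⟨e, rfl, rfl, (hmem e).1 hf⟩
    · rintro ⟨e, rfl, rfl, h⟩
      exact ⟨(hmem e).2 h, e, rfl, rfl⟩
  have hsum : ∑ c, ∑ f ∈ Φ with P.Touches c (.inl f), x c = 0 := by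
    have h : ∑ f ∈ Φ, ∑ c with P.Touches c (.inl f), x c = 0 :=
      Finset.sum_eq_zero fun f _ => hx f
    simp only [Finset.sum_filter] at h ⊢
    rwa [Finset.sum_comm] at h
  have hd' : (Φ.filter fun f => P.Touches (P.crossingOf d) (.inl f)) =
      {P.faceOf (P.rot d)} := by
    ext f
    rw [hfilter, Finset.mem_singleton]
    constructor
    · rintro ⟨e, he, rfl, h1, h2⟩
      rcases crossingOf_eq_iff.1 he with rfl | rfl | rfl | rfl
      · exact absurd h1 (hself _)
      · rfl
      · rw [← hd] at h1
        exact absurd h1 (hself _)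
      · exact absurd h2 hA.rot_rot_rot_notMem
    · rintro rfl
      exact ⟨P.rot d, by simp, rfl, ha d, hA.rot_mem_self⟩
  -- Summing the relations over `Φ`, the crossing of `d` is counted once. Any other crossing inside
  -- `A` has two corners of the chosen colour: in distinct faces they cancel, and in a common face
  -- the crossing is reducible with a smaller side.
  rw [Finset.sum_eq_single (P.crossingOf d)] at hsum
  · rwa [hd', Finset.sum_singleton] at hsum
  · intro c _ hc
    obtain ⟨e, rfl, he⟩ : ∃ e, P.crossingOf e = c ∧ a (P.faceOf e) = a (P.faceOf d) + 1 := by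
      obtain ⟨e, rfl⟩ := P.crossingOf_surjective c
      by_cases h : a (P.faceOf e) = a (P.faceOf d)
      · exact ⟨P.rot e, by simp, by rw [ha, h]⟩
      · exact ⟨e, rfl, (hdec _ _).1 h⟩
    by_cases heA : e ∈ A
    · have h : (Φ.filter fun f => P.Touches (P.crossingOf e) (.inl f)) =
          {P.faceOf e, P.faceOf (P.rot (P.rot e))} := by
        ext f
        rw [hfilter, Finset.mem_insert, Finset.mem_singleton]
        constructor
        · rintro ⟨e', he', rfl, h1, h2⟩
          rcases crossingOf_eq_iff.1 he' with rfl | rfl | rfl | rfl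
          · exact .inl rfl
          · rw [ha, he] at h1
            exact absurd h1.symm (hself _)
          · exact .inr rfl
          · rw [ha, ha, ha, he, hadd, hadd] at h1
            exact absurd h1 (hself _)
        · rintro (rfl | rfl)
          · exact ⟨e, rfl, rfl, he, heA⟩
          · refine ⟨_, by simp, rfl, by rw [ha, ha, hadd, he],
              (hA.mem_iff_of_crossingOf_eq hc (by simp)).2 heA⟩
      rw [h]
      by_cases hee : P.faceOf e = P.faceOf (P.rot (P.rot e))
      · obtain ⟨e', B, h1, h2, h3, h4⟩ := exists_separates_ssubset hA hee heA hc
        have := ih _ (Set.ncard_lt_ncard h4) h3 h2 rfl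
        rw [h1] at this
        simp [this]
      · rw [Finset.sum_pair hee, CharTwo.add_self_eq_zero]
    · rw [Finset.sum_eq_zero]
      intro f hf
      obtain ⟨e', h1, -, -, h2⟩ := (hfilter _ _).1 hf
      exact absurd ((hA.mem_iff_of_crossingOf_eq hc h1).1 h2) heA
  · simp

open scoped Classical in
/-- A function on the crossings whose sum over the crossings touching `f` vanishes for each face `f`
is zero. -/
theorem eq_zero_of_sum_touches [Finite δ] [Fintype P.Crossing]
    {a : P.Face → ZMod 2} (ha : ∀ d, a (P.faceOf (P.rot d)) = a (P.faceOf d) + 1)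
    {x : P.Crossing → ZMod 2} (hx : ∀ f : P.Face, ∑ c with P.Touches c (.inl f), x c = 0) :
    x = 0 := by
  have := Fintype.ofFinite δ
  have hred : ∀ d, P.faceOf d = P.faceOf (P.rot (P.rot d)) → x (P.crossingOf d) = 0 := by
    intro d hd
    obtain ⟨A, hA⟩ := exists_separates hd
    exact eq_zero_of_separates ha hx hA hd
  have hne : ∀ d, P.faceOf (P.rot d) ≠ P.faceOf d := by
    intro d h
    have := ha d
    rw [h] at this
    simp at this
  obtain ⟨g, hg, hz⟩ := exists_potential (P := P) (z := fun d => x (P.crossingOf d))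
    (fun f => by
      refine Eq.trans ?_ (hx f)
      rw [Finset.sum_filter, sum_eq_sum_crossings (P := P), Finset.sum_filter]
      refine Finset.sum_congr rfl fun c _ => ?_
      obtain ⟨d, rfl⟩ := P.crossingOf_surjective c
      rw [sum_crossingOf_eq]
      have ht : P.Touches (P.crossingOf d) (.inl f) ↔ P.faceOf d = f ∨ P.faceOf (P.rot d) = f ∨
          P.faceOf (P.rot (P.rot d)) = f ∨ P.faceOf (P.rot (P.rot (P.rot d))) = f := by
        simp only [Touches, Sum.inl.injEq, crossingOf_eq_iff]
        constructor
        · rintro ⟨e, rfl | rfl | rfl | rfl, h⟩ <;> simp [h]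
        · rintro (h | h | h | h)
          · exact ⟨_, .inl rfl, h⟩
          · exact ⟨_, .inr (.inl rfl), h⟩
          · exact ⟨_, .inr (.inr (.inl rfl)), h⟩
          · exact ⟨_, .inr (.inr (.inr rfl)), h⟩
      simp only [crossingOf_rot, ht]
      -- Counting corners and counting touching crossings differ only where a face repeats at a
      -- crossing, and there `x` vanishes.
      by_cases hxd : x (P.crossingOf d) = 0
      · simp [hxd]
      · have h1 := hne d
        have h2 := hne (P.rot d)
        have h3 := hne (P.rot (P.rot d))
        have h4 := hne (P.rot (P.rot (P.rot d)))
        rw [P.rot_four] at h4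
        have h5 := mt (hred d) hxd
        have h6 := mt (hred (P.rot d)) (by rwa [crossingOf_rot])
        by_cases k1 : P.faceOf d = f
        · subst k1; simp [h1, Ne.symm h5, h4.symm]
        by_cases k2 : P.faceOf (P.rot d) = f
        · subst k2; simp [k1, h2, Ne.symm h6]
        by_cases k3 : P.faceOf (P.rot (P.rot d)) = f
        · subst k3; simp [k1, k2, h3]
        simp [k1, k2, k3])
    (fun c => by
      obtain ⟨d, rfl⟩ := P.crossingOf_surjective c
      rw [sum_crossingOf_eq]
      simp only [crossingOf_rot]
      rw [CharTwo.add_self_eq_zero, zero_add, CharTwo.add_self_eq_zero])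
  -- Adjacent corners carry the same value of `x`, so `g d = g (rot (rot d))`: `g` is constant along
  -- the knot.
  have hconst := eq_of_straight (P := P) (f := g) hg fun d => by
    have h1 := hz d
    have h2 := hz (P.rot d)
    rw [crossingOf_rot, h1, add_comm] at h2
    exact (add_left_cancel h2).symm
  funext c
  obtain ⟨d, rfl⟩ := P.crossingOf_surjective c
  rw [hz d, hconst d (P.rot d), CharTwo.add_self_eq_zero, Pi.zero_apply]

end Reducible

end KnotProjection

/-! ### Rank and kernel of the incidence matrix -/

namespace KnotProjection

section Incidence

variable {δ : Type*} (P : KnotProjection δ)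

open scoped Classical in
/-- The incidence matrix of crossings and regions over the field with two elements. -/
noncomputable def touchMatrix : Matrix P.Crossing P.Region (ZMod 2) :=
  Matrix.of fun c R => if P.Touches c R then 1 else 0

variable {P}

theorem touchMatrix_eq_one_iff {c : P.Crossing} {R : P.Region} :
    P.touchMatrix c R = 1 ↔ P.Touches c R := by
  simp [touchMatrix]

variable [Finite δ]

noncomputable instance : Fintype P.Region := Fintype.ofFinite _

noncomputable instance : Fintype P.Crossing := Fintype.ofFinite _

theorem rank_touchMatrix (D : KnotDiagram P) : P.touchMatrix.rank = Nat.card P.Crossing := by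
  classical
  have := Fintype.ofFinite δ
  -- The over-strands supply the alternating function from which the colouring is built.
  obtain ⟨a, ha⟩ := exists_checkerboard (P := P) (t := fun d => if D.isOver d then 1 else 0)
    (fun d => by
      simp only [D.isOver_rot]
      by_cases h : D.isOver d <;> simp [h, CharTwo.add_self_eq_zero])
  rw [Nat.card_eq_fintype_card]
  refine LinearIndependent.rank_matrix (Fintype.linearIndependent_iff.2 fun x hx => ?_)
  refine congrFun (eq_zero_of_sum_touches ha fun f => ?_)
  let R : P.Region := .inl f
  have h := congrFun hx R
  rw [Finset.sum_apply] at h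
  refine Eq.trans ?_ h
  rw [Finset.sum_filter]
  refine Finset.sum_congr rfl fun c _ => ?_
  change _ = x c * (if P.Touches c R then 1 else 0)
  rw [mul_ite, mul_one, mul_zero]

theorem touchMatrix_mulVec_surjective (D : KnotDiagram P) :
    Function.Surjective P.touchMatrix.mulVecLin := by
  rw [← LinearMap.range_eq_top]
  refine Submodule.eq_top_of_finrank_eq ?_
  rw [finrank_pi_eq_natCard]
  exact rank_touchMatrix D

theorem ncard_ker_touchMatrix (D : KnotDiagram P) :
    (P.touchMatrix.mulVecLin.ker : Set (P.Region → ZMod 2)).ncard = 4 := by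
  classical
  have h1 := P.touchMatrix.mulVecLin.finrank_range_add_finrank_ker
  have h2 : Module.finrank (ZMod 2) P.touchMatrix.mulVecLin.range = _ := rank_touchMatrix D
  rw [finrank_pi_eq_natCard, card_region, h2] at h1
  have h3 : Module.finrank (ZMod 2) P.touchMatrix.mulVecLin.ker = 2 := by omega
  have h4 := Module.natCard_eq_pow_finrank (K := ZMod 2) (V := P.touchMatrix.mulVecLin.ker)
  rw [h3, Nat.card_zmod] at h4
  exact h4

end Incidence

end KnotProjection

/-! ### From linear algebra back to diagrams -/

namespace KnotDiagram

section Changes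

variable {δ : Type*} {P : KnotProjection δ}

theorem ext_isOver {D E : KnotDiagram P} (h : ∀ d, D.isOver d ↔ E.isOver d) : D = E := by
  cases D
  cases E
  congr
  exact funext fun d => propext (h d)

theorem crossingChange_empty (D : KnotDiagram P) : D.crossingChange ∅ = D :=
  ext_isOver fun d => by simp [crossingChange]

theorem crossingChange_eq_self_iff {D : KnotDiagram P} {C : Set P.Crossing} :
    D.crossingChange C = D ↔ C = ∅ := by
  refine ⟨fun h => ?_, fun h => h ▸ D.crossingChange_empty⟩
  refine Set.eq_empty_of_forall_notMem fun c hc => ?_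
  obtain ⟨d, rfl⟩ := P.crossingOf_surjective c
  have : (D.crossingChange C).isOver d ↔ D.isOver d := by rw [h]
  simp [crossingChange, hc] at this

theorem crossingChange_crossingChange (D : KnotDiagram P) (v w : P.Crossing → ZMod 2) :
    (D.crossingChange {c | v c = 1}).crossingChange {c | w c = 1} =
      D.crossingChange {c | v c + w c = 1} := by
  refine ext_isOver fun d => ?_
  have h : ∀ x y : ZMod 2, x + y = 1 ↔ (x = 1 ∧ ¬ y = 1) ∨ (¬ x = 1 ∧ y = 1) := by decide
  simp only [crossingChange, Set.mem_ofPred_eq, h]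
  tauto

theorem foldl_crossingChange {α : Type*} (m : α → P.Crossing → ZMod 2) (l : List α)
    (D : KnotDiagram P) :
    l.foldl (fun D R => D.crossingChange {c | m R c = 1}) D =
      D.crossingChange {c | (l.map (m · c)).sum = 1} := by
  induction l generalizing D with
  | nil => simpa using D.crossingChange_empty.symm
  | cons R l ih =>
    rw [List.foldl_cons, ih, crossingChange_crossingChange D (m R)]
    simp

theorem regionCrossingChanges_eq (D : KnotDiagram P) (l : List P.Region) :
    D.regionCrossingChanges l =
      D.crossingChange {c | (l.map (P.touchMatrix c ·)).sum = 1} := by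
  rw [← foldl_crossingChange (fun R c => P.touchMatrix c R)]
  simp only [KnotProjection.touchMatrix_eq_one_iff]
  rfl

theorem regionFreezeCrossingChanges_eq (D : KnotDiagram P) (l : List P.Region) :
    D.regionFreezeCrossingChanges l =
      D.crossingChange {c | (l.map fun R => 1 + P.touchMatrix c R).sum = 1} := by
  rw [← foldl_crossingChange (fun R c => 1 + P.touchMatrix c R)]
  have h : ∀ x : ZMod 2, 1 + x = 1 ↔ ¬ x = 1 := by decide
  simp only [h, KnotProjection.touchMatrix_eq_one_iff]
  rfl

theorem ineffective_iff {D : KnotDiagram P} {S : Finset P.Region} :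
    D.Ineffective S ↔ ∀ c, ∑ R ∈ S, P.touchMatrix c R = 0 := by
  classical
  have h01 : ∀ x : ZMod 2, x ≠ 1 ↔ x = 0 := by decide
  have key : ∀ l : List P.Region, l.Nodup → (∀ R, R ∈ l ↔ R ∈ S) →
      (D.regionCrossingChanges l = D ↔ ∀ c, ∑ R ∈ S, P.touchMatrix c R = 0) := by
    intro l hl h
    have hS : S = l.toFinset := by ext R; simp [h]
    rw [regionCrossingChanges_eq, crossingChange_eq_self_iff, Set.eq_empty_iff_forall_notMem]
    refine forall_congr' fun c => ?_
    rw [Set.mem_ofPred_eq, ← ne_eq, h01, hS, List.sum_toFinset _ hl]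
  refine ⟨fun h => ?_, fun h l hl hS => (key l hl hS).2 h⟩
  -- Ineffectiveness quantifies over all enumerations of `S`; that one exists keeps it from being
  -- vacuous.
  exact (key S.toList S.nodup_toList fun R => S.mem_toList).1
    (h S.toList S.nodup_toList fun R => S.mem_toList)

variable [Finite δ]

theorem ncard_ineffective (D : KnotDiagram P) :
    {S : Finset P.Region | D.Ineffective S}.ncard = 4 := by
  classical
  let χ : Finset P.Region → P.Region → ZMod 2 := fun S R => if R ∈ S then 1 else 0
  have hinj : Function.Injective χ := fun S T h => by
    ext R
    have := congrFun h R
    by_cases h1 : R ∈ S <;> by_cases h2 : R ∈ T <;> simp_all [χ]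
  have hmul : ∀ S, χ S ∈ P.touchMatrix.mulVecLin.ker ↔ D.Ineffective S := by
    intro S
    rw [LinearMap.mem_ker, ineffective_iff, funext_iff]
    simp [χ, Matrix.mulVec, dotProduct]
  rw [← Set.ncard_image_of_injective _ hinj, ← KnotProjection.ncard_ker_touchMatrix D]
  congr 1
  ext y
  constructor
  · rintro ⟨S, hS, rfl⟩
    exact (hmul S).2 hS
  · intro hy
    have h01 : ∀ x : ZMod 2, (if x = 1 then 1 else 0) = x := by decide
    have hχ : χ (Finset.univ.filter fun R => y R = 1) = y := funext fun R => by simp [χ, h01]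
    exact ⟨_, (hmul _).1 (by rwa [hχ]), hχ⟩

theorem exists_sum_touchMatrix_eq (D : KnotDiagram P) (v : P.Crossing → ZMod 2) :
    ∃ T : Finset P.Region, ∀ c, ∑ R ∈ T, P.touchMatrix c R = v c := by
  classical
  obtain ⟨y, rfl⟩ := KnotProjection.touchMatrix_mulVec_surjective D v
  refine ⟨Finset.univ.filter fun R => y R = 1, fun c => ?_⟩
  have h01 : ∀ x u : ZMod 2, (if x = 1 then u else 0) = u * x := by decide
  simp only [Finset.sum_filter, h01]
  rfl

theorem exists_regionFreezeCrossingChanges_eq {D : KnotDiagram P} {S : Finset P.Region}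
    (hS : D.Ineffective S) (hodd : Odd S.card) (c : P.Crossing) :
    ∃ l : List P.Region, D.regionFreezeCrossingChanges l = D.crossingChange {c} := by
  classical
  obtain ⟨T, hT⟩ := D.exists_sum_touchMatrix_eq (Pi.single c 1)
  have hsum : ∀ (U : Finset P.Region) (b : P.Crossing),
      (U.toList.map fun R => 1 + P.touchMatrix b R).sum =
        U.card + ∑ R ∈ U, P.touchMatrix b R := by
    intro U b
    rw [Finset.sum_map_toList, Finset.sum_add_distrib]
    simp
  have hsingle : {b | (Pi.single c 1 : P.Crossing → ZMod 2) b = 1} = {c} := by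
    ext b
    simp [Pi.single_apply]
  rcases Nat.even_or_odd T.card with h | h
  · refine ⟨T.toList, ?_⟩
    rw [regionFreezeCrossingChanges_eq, ← hsingle]
    simp only [hsum, hT, (ZMod.natCast_eq_zero_iff_even).2 h, zero_add]
  · refine ⟨T.toList ++ S.toList, ?_⟩
    rw [regionFreezeCrossingChanges_eq, ← hsingle]
    simp only [List.map_append, List.sum_append, hsum, hT, ineffective_iff.1 hS,
      (ZMod.natCast_eq_one_iff_odd).2 h, (ZMod.natCast_eq_one_iff_odd).2 hodd, add_zero]
    simp only [add_right_comm, CharTwo.add_self_eq_zero, zero_add]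

end Changes

end KnotDiagram

theorem mainTheorem1 {δ : Type*} [Finite δ] (P : KnotProjection δ) (D : KnotDiagram P) :
    {S : Finset P.Region | D.Ineffective S}.ncard = 4 ∧
    ((∃ S : Finset P.Region, D.Ineffective S ∧ Odd S.card) →
      ∀ c : P.Crossing, ∃ l : List P.Region,
        D.regionFreezeCrossingChanges l = D.crossingChange {c}) :=
  ⟨D.ncard_ineffective, fun ⟨_, hS, hodd⟩ c =>
    KnotDiagram.exists_regionFreezeCrossingChanges_eq hS hodd c⟩
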